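/- Let $\mathbb K=\mathbb R$ or $\mathbb C$, let $n_{\mathbb K}:=\dim_{\mathbb R}\mathbb K^n$, embed $\mathbb K^n$ into $\mathbb{KP}^n$ by $x\mapsto[x:1]$, and let $\mathbf H_\infty:=\mathbb{KP}^n\setminus\mathbb K^n$ be the hyperplane at infinity. Identify $\mathbb K^n$ with the Euclidean space $\mathbb R^{n_{\mathbb K}}$. Definitions. For $N\ge 1$ the space $\mathbb R^N$ is compactified as a smooth manifold with boundary $\overline{\mathbb R^N}$, covered by the two charts $\mathbb R^N$ and $[0,\infty)\times\mathbb S^{N-1}$, which are glued along $(0,\infty)\times\mathbb S^{N-1}\to\mathbb R^N\setminus\{0\}$, $(r,u)\mapsto u/r$; its boundary is $\{0\}\times\mathbb S^{N-1}$. For $S\subset\mathbb R^N$ let $\overline S$ be its closure in $\overline{\mathbb R^N}$ and let $S^\infty\subset\mathbb S^{N-1}$ be defined by $\{0\}\times S^\infty=\overline S\cap(\{0\}\times\mathbb S^{N-1})$. A subset $P$ of a smooth manifold with boundary $(M,\partial M)$ is a p-submanifold if it is a smooth submanifold with boundary $\partial P$ of $M$, $\partial P=P\cap\partial M$, and $T_xP+T_x\partial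 M=T_xM$ for all $x\in\partial P$. The set $S$ is conic at $\infty$ if either $S$ is bounded, or $S^\infty\neq\emptyset$ and some open neighbourhood $W$ of $\{0\}\times S^\infty$ in $\overline{\mathbb R^N}$ is such that $\overline S\cap W$ is a p-submanifold of $W$. Lemma 4.2. Let $X$ be a closed connected smooth (real) submanifold, without boundary, of $\mathbb{KP}^n$ of real dimension $d$ with $0<d<n_{\mathbb K}$. Assume that $X\cap\mathbf H_\infty$ is not empty and that $X$ is transverse to $\mathbf H_\infty$, that is $T_xX+T_x\mathbf H_\infty=T_x\mathbb{KP}^n$ (as real vector spaces) for all $x\in X\cap\mathbf H_\infty$. Then the affine part $X\setminus\mathbf H_\infty\subset\mathbb K^n=\mathbb R^{n_{\mathbb K}}$ is conic at $\infty$. -/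

import Mathlib

open Set
open scoped ContDiff LinearAlgebra.Projectivization

noncomputable section

/-! ### Smooth submanifolds of a finite-dimensional real vector space -/

section Submanifolds

variable {V : Type*} [NormedAddCommGroup V] [NormedSpace ℝ V]

/-- `x` is an interior point of the `d`-dimensional submanifold with boundary `N` of `V`:
near `x` there is a smooth chart `Φ` of `V` which carries `N` onto the slice `ℝ^d × {0}` of
`ℝ^d × ℝ^c`. -/
def IsInteriorPoint (N : Set V) (d : ℕ) (x : V) : Prop :=
  x ∈ N ∧ ∃ (c : ℕ)
    (Φ : OpenPartialHomeomorph V (EuclideanSpace ℝ (Fin d) × EuclideanSpace ℝ (Fin c))),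
    x ∈ Φ.source ∧ ContDiffOn ℝ ∞ Φ Φ.source ∧ ContDiffOn ℝ ∞ Φ.symm Φ.target ∧
    N ∩ Φ.source = {y ∈ Φ.source | (Φ y).2 = 0}

/-- `x` is a boundary point of the `d`-dimensional submanifold with boundary `N` of `V`:
near `x` there is a smooth chart `Φ` of `V` which carries `N` onto the half slice
`([0,∞) × ℝ^k) × {0}` of `(ℝ × ℝ^k) × ℝ^c`, with `d = k + 1`, and `x` to a point of
`({0} × ℝ^k) × {0}`. -/
def IsBoundaryPoint (N : Set V) (d : ℕ) (x : V) : Prop :=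
  x ∈ N ∧ ∃ (k c : ℕ)
    (Φ : OpenPartialHomeomorph V
      ((ℝ × EuclideanSpace ℝ (Fin k)) × EuclideanSpace ℝ (Fin c))),
    d = k + 1 ∧
    x ∈ Φ.source ∧ ContDiffOn ℝ ∞ Φ Φ.source ∧ ContDiffOn ℝ ∞ Φ.symm Φ.target ∧
    N ∩ Φ.source = {y ∈ Φ.source | 0 ≤ (Φ y).1.1 ∧ (Φ y).2 = 0} ∧ (Φ x).1.1 = 0

/-- `N` is a smooth (embedded) `d`-dimensional submanifold, without boundary, of `V`. -/
def IsSmoothSubmanifold (N : Set V) (d : ℕ) : Prop :=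
  ∀ x ∈ N, IsInteriorPoint N d x

/-- `N` is a smooth (embedded) `d`-dimensional submanifold, with a possibly empty boundary,
of `V`. -/
def IsSmoothSubmanifoldWithBoundary (N : Set V) (d : ℕ) : Prop :=
  ∀ x ∈ N, IsInteriorPoint N d x ∨ IsBoundaryPoint N d x

/-- The boundary of the `d`-dimensional submanifold with boundary `N`. -/
def submanifoldBoundary (N : Set V) (d : ℕ) : Set V :=
  {x | IsBoundaryPoint N d x}

/-- The tangent space at `x` of a submanifold (possibly with boundary) `N` of `V`: the linear
span of all limits of `c_k • (x_k - x)` with `c_k ∈ ℝ`, `x_k ∈ N` and `x_k → x`.  At a boundary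
point this is the whole tangent space, not only a half space. -/
def tangentSubspace (N : Set V) (x : V) : Submodule ℝ V :=
  Submodule.span ℝ (tangentConeAt ℝ N x)

/-- Let `M` be a submanifold with boundary `bM` of `V`.  The set `N` is a `d`-dimensional
p-submanifold of `M`: it is a smooth submanifold with boundary contained in `M` (for subsets of
`M`, being a submanifold of `M` and being one of `V` are the same thing), its boundary points are
exactly its points on the boundary of `M`, and at these it is transverse to the boundary
of `M`. -/
def IsPSubmanifold (M bM N : Set V) (d : ℕ) : Prop :=
  N ⊆ M ∧ IsSmoothSubmanifoldWithBoundary N d ∧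
  submanifoldBoundary N d = N ∩ bM ∧
  ∀ x ∈ submanifoldBoundary N d,
    tangentSubspace N x ⊔ tangentSubspace bM x = tangentSubspace M x

end Submanifolds

/-! ### Compactification by a sphere at infinity, sets that are conic at infinity

The compactification of the Euclidean space `E` is covered by the two open charts `E` and
`[0,∞) × S`, with `S` the unit sphere of `E`; they are glued along `(0,∞) × S ≃ E \ {0}`,
`(r, u) ↦ u / r`, and the boundary is `{0} × S`.  Whatever happens near the boundary takes place in
the chart `[0,∞) × S`, a closed subset (and a submanifold with boundary) of `ℝ × E`. -/

section ConicAtInfinity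

variable {E : Type*} [NormedAddCommGroup E] [NormedSpace ℝ E]

variable (E) in
/-- The chart `[0,∞) × S` of the compactification at its boundary. -/
def chartAtInfinity : Set (ℝ × E) := Ici 0 ×ˢ Metric.sphere 0 1

variable (E) in
/-- The sphere at infinity `{0} × S`. -/
def sphereAtInfinity : Set (ℝ × E) := {0} ×ˢ Metric.sphere 0 1

/-- The trace on the chart `[0,∞) × S` of the closure of `X ⊆ E` in the compactification. As the
chart is open in the compactification and closed in `ℝ × E`, this is the closure in `ℝ × E` of
the set of all `(r, u)` with `r > 0`, `‖u‖ = 1` and `u / r ∈ X`. -/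
def closureAtInfinity (X : Set E) : Set (ℝ × E) :=
  closure {p | 0 < p.1 ∧ ‖p.2‖ = 1 ∧ p.1⁻¹ • p.2 ∈ X}

/-- The set `{0} × X^∞`, with `X^∞ ⊆ S` the asymptotic set of `X` at infinity. -/
def asymptoticSet (X : Set E) : Set (ℝ × E) :=
  closureAtInfinity X ∩ sphereAtInfinity E

/-- A subset `X` of the Euclidean space `E` is conic at infinity if it is bounded, or if the germ
of its closure along `{0} × X^∞` is non-empty and is the germ of a smooth p-submanifold of the
compactification. -/
def IsConicAtInfinity (X : Set E) : Prop :=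
  Bornology.IsBounded X ∨
    ((asymptoticSet X).Nonempty ∧
      ∃ W : Set (ℝ × E), IsOpen W ∧ asymptoticSet X ⊆ W ∧
        ∃ d : ℕ, IsPSubmanifold (chartAtInfinity E ∩ W) (sphereAtInfinity E ∩ W)
          (closureAtInfinity X ∩ W) d)

end ConicAtInfinity

/-! ### Projective space, its standard affine charts and its real submanifolds -/

section Projective

/-- The quotient topology on the projectivization of a topological vector space. -/
instance instTopologicalSpaceProjectivization (K V : Type*) [DivisionRing K] [AddCommGroup V]
    [Module K V] [TopologicalSpace V] : TopologicalSpace (ℙ K V) :=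
  TopologicalSpace.coinduced (Projectivization.mk' K : {v : V // v ≠ 0} → ℙ K V) inferInstance

variable {𝕂 : Type*} [RCLike 𝕂] {n : ℕ}

/-- The inverse of the `i`-th standard affine chart of `𝕂ℙⁿ`: it inserts the homogeneous coordinate
`1` at position `i`. For `i = n` it is the embedding `x ↦ [x : 1]` of `𝕂ⁿ`. -/
def affineEmbedding (i : Fin (n + 1)) (x : EuclideanSpace 𝕂 (Fin n)) :
    ℙ 𝕂 (Fin (n + 1) → 𝕂) :=
  Projectivization.mk 𝕂 (i.insertNth (1 : 𝕂) (fun j => x j)) (by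
    intro h
    simpa using congrFun h i)

variable (𝕂 n) in
/-- The hyperplane at infinity of `𝕂ℙⁿ`, the complement of `𝕂ⁿ`. -/
def hyperplaneAtInfinity : Set (ℙ 𝕂 (Fin (n + 1) → 𝕂)) :=
  (range (affineEmbedding (𝕂 := 𝕂) (Fin.last n)))ᶜ

/-- The affine part of `X ⊆ 𝕂ℙⁿ`, as a subset of `𝕂ⁿ`. -/
def affinePart (X : Set (ℙ 𝕂 (Fin (n + 1) → 𝕂))) : Set (EuclideanSpace 𝕂 (Fin n)) :=
  affineEmbedding (Fin.last n) ⁻¹' X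

/-- `X` is a smooth (embedded, without boundary) real submanifold of `𝕂ℙⁿ` of real dimension `d`:
it is one in each of the standard affine charts, where `𝕂ⁿ` is seen as a real vector space. -/
def IsProjectiveSubmanifold (X : Set (ℙ 𝕂 (Fin (n + 1) → 𝕂))) (d : ℕ) : Prop :=
  ∀ i : Fin (n + 1), IsSmoothSubmanifold (affineEmbedding i ⁻¹' X) d

/-- The submanifolds `X` and `Y` of `𝕂ℙⁿ` are transverse: at each common point their real tangent
spaces, read in the standard affine charts, together span the tangent space of `𝕂ℙⁿ`. -/
def ProjectiveTransverse (X Y : Set (ℙ 𝕂 (Fin (n + 1) → 𝕂))) : Prop :=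
  ∀ (i : Fin (n + 1)) (x : EuclideanSpace 𝕂 (Fin n)), affineEmbedding i x ∈ X ∩ Y →
    tangentSubspace (affineEmbedding i ⁻¹' X) x ⊔
      tangentSubspace (affineEmbedding i ⁻¹' Y) x = ⊤

end Projective

end

/-! ### Curves and tangent vectors -/

open Filter Topology

/-! The point `u / r` of the affine space is `[u : r]` in projective space, and `(r, u) ↦ [u : r]`
still makes sense at `r = 0`. So the closure of the affine part in the chart `[0,∞) × S` should be
the set `N` of all `(r, u)` in that chart with `[u : r] ∈ X`, and `N` should be a p-submanifold of
the whole chart, without shrinking to a neighbourhood of infinity.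

Locally `N` is given by `0 ≤ r`, `‖u‖² = 1` and `h = 0`, where `h` is a local equation of `X`
composed with an affine chart. Moving along `p = (r, u)` itself changes the norm but not the
projective point, so the norm equation is independent of the others. For `r > 0` this makes `N` a
manifold. At `r = 0`, transversality says that the differential of the equation of `X` is onto
already on directions tangent to the hyperplane at infinity; these lift to vectors with zero
`r`-component, so `r`, the norm equation and `h` are jointly submersive (`boundary_of_fst_eq_zero`).
This yields a boundary chart and a tangent vector with `r`-component `1`. That vector shows both
that `p` is a limit of points with `r > 0`, hence that `N` is no larger than the closure, and that
`N` is transverse to the sphere at infinity. -/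

/-- A differentiable curve in a set is tangent to it. -/
theorem mem_tangentConeAt_of_curve {V : Type*} [NormedAddCommGroup V] [NormedSpace ℝ V]
    {S : Set V} {x v : V} {γ : ℝ → V} (hγ : HasDerivAt γ v 0) (h0 : γ 0 = x)
    (hS : ∀ᶠ t in 𝓝[>] (0 : ℝ), γ t ∈ S) : v ∈ tangentConeAt ℝ S x := by
  refine mem_tangentConeAt_of_seq (𝓝[>] (0 : ℝ)) (fun t => t⁻¹) (fun t => γ t - x) ?_ ?_ ?_
  · have := hγ.continuousAt.tendsto.mono_left (nhdsWithin_le_nhds (s := Ioi 0))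
    rw [h0] at this
    simpa using this.sub_const x
  · simpa using hS
  · have := hγ.tendsto_slope_zero_right
    simpa [h0] using this

/-- A vector in the kernel of the derivative of a submersion is the velocity of a curve in the
level set. -/
theorem HasStrictFDerivAt.exists_curve {V F : Type*} [NormedAddCommGroup V] [NormedSpace ℝ V]
    [NormedAddCommGroup F] [NormedSpace ℝ F] [CompleteSpace V] [FiniteDimensional ℝ F]
    {g : V → F} {g' : V →L[ℝ] F} {x v : V} (hg : HasStrictFDerivAt g g' x)
    (hsurj : Function.Surjective g') (hv : g' v = 0) :
    ∃ γ : ℝ → V, HasDerivAt γ v 0 ∧ γ 0 = x ∧ ∀ᶠ t in 𝓝 (0 : ℝ), g (γ t) = g x := by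
  have hr : g'.range = ⊤ := LinearMap.range_eq_top.2 hsurj
  let w : g'.ker := ⟨v, hv⟩
  have hl : HasDerivAt (fun t : ℝ => t • w) w 0 := by
    simpa using (hasDerivAt_id (0 : ℝ)).smul_const w
  refine ⟨fun t => hg.implicitFunction g g' hr (g x) (t • w), ?_, by simp, ?_⟩
  · have h1 := (hg.to_implicitFunction hr).hasFDerivAt
    have h2 : HasFDerivAt (hg.implicitFunction g g' hr (g x)) g'.ker.subtypeL
      ((fun t : ℝ => t • w) 0) := by simpa using h1
    exact h2.comp_hasDerivAt (0 : ℝ) hl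
  · have h := hg.map_implicitFunction_eq hr
    have ht : Tendsto (fun t : ℝ => (g x, t • w)) (𝓝 0) (𝓝 (g x, 0)) := by
      have : Continuous fun t : ℝ => (g x, t • w) := by fun_prop
      simpa using this.tendsto 0
    exact ht.eventually h
-- Level sets of submersions: charts, tangent spaces, boundary points
section LevelSets

variable {V F : Type*} [NormedAddCommGroup V] [NormedSpace ℝ V] [NormedAddCommGroup F]
  [NormedSpace ℝ F]

/-- A submersion is locally, in a suitable smooth chart of the source, a linear projection. -/
theorem exists_chart_snd_eq [FiniteDimensional ℝ V] [FiniteDimensional ℝ F] {g : V → F}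
    {U : Set V} (hU : IsOpen U) (hg : ContDiffOn ℝ ∞ g U) {x : V} (hx : x ∈ U)
    (hsurj : Function.Surjective (fderiv ℝ g x)) {d : ℕ}
    (hd : Module.finrank ℝ V = d + Module.finrank ℝ F) :
    ∃ Φ : OpenPartialHomeomorph V (EuclideanSpace ℝ (Fin d) × F),
      x ∈ Φ.source ∧ Φ.source ⊆ U ∧ ContDiffOn ℝ ∞ Φ Φ.source ∧
      ContDiffOn ℝ ∞ Φ.symm Φ.target ∧ ∀ y, (Φ y).2 = g y := by
  have : CompleteSpace V := FiniteDimensional.complete ℝ V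
  set g' := fderiv ℝ g x with hg'
  have hkerdim : Module.finrank ℝ g'.ker = d := by
    have h1 := LinearMap.finrank_range_add_finrank_ker (g' : V →ₗ[ℝ] F)
    rw [LinearMap.range_eq_top.2 hsurj, finrank_top] at h1
    omega
  obtain ⟨p, hp⟩ := g'.ker_closedComplemented_of_finiteDimensional_range
  let ι : g'.ker ≃L[ℝ] EuclideanSpace ℝ (Fin d) :=
    ContinuousLinearEquiv.ofFinrankEq (by rw [hkerdim]; simp)
  -- A projection onto the kernel of `g'` supplies the coordinates that `g` misses.
  let π : V →L[ℝ] EuclideanSpace ℝ (Fin d) := (ι : g'.ker →L[ℝ] _) ∘L p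
  have hinj : Function.Injective (π.prod g') := by
    rw [injective_iff_map_eq_zero]
    intro v hv
    obtain ⟨h1, h2⟩ := Prod.ext_iff.1 hv
    have h3 : p v = ⟨v, h2⟩ := hp ⟨v, h2⟩
    have h4 : p v = 0 := ι.injective (by simpa [π] using h1)
    simpa using congrArg Subtype.val (h3.symm.trans h4)
  let A : V ≃L[ℝ] EuclideanSpace ℝ (Fin d) × F :=
    (LinearEquiv.ofInjectiveOfFinrankEq (π.prod g' : V →ₗ[ℝ] _) hinj
      (by simp [hd])).toContinuousLinearEquiv
  have hA : (A : V →L[ℝ] EuclideanSpace ℝ (Fin d) × F) = π.prod g' := by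
    ext v <;> rfl
  let Ψ : V → EuclideanSpace ℝ (Fin d) × F := fun y => (π y, g y)
  have hΨ : ContDiffOn ℝ ∞ Ψ U := π.contDiff.contDiffOn.prodMk hg
  have hΨx : HasFDerivAt Ψ (A : V →L[ℝ] EuclideanSpace ℝ (Fin d) × F) x := by
    rw [hA]
    exact π.hasFDerivAt.prodMk
      ((hg.contDiffAt (hU.mem_nhds hx)).differentiableAt (by simp)).hasFDerivAt
  let Φ := (hΨ.contDiffAt (hU.mem_nhds hx)).toOpenPartialHomeomorph Ψ hΨx (by simp)
  -- The inverse must be smooth on the whole target, so the chart is cut down to the open set where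
  -- the differential stays invertible.
  let O : Set V := U ∩ fderiv ℝ Ψ ⁻¹'
    range ((↑) : (V ≃L[ℝ] EuclideanSpace ℝ (Fin d) × F) → V →L[ℝ] EuclideanSpace ℝ (Fin d) × F)
  have hO : IsOpen O :=
    (hΨ.continuousOn_fderiv_of_isOpen hU (by simp)).isOpen_inter_preimage hU
      (ContinuousLinearEquiv.isOpen)
  have hxO : x ∈ O := ⟨hx, A, hΨx.fderiv.symm⟩
  refine ⟨Φ.restrOpen O hO, ⟨?_, hxO⟩, fun y hy => hy.2.1, ?_, ?_, fun y => rfl⟩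
  · exact ContDiffAt.mem_toOpenPartialHomeomorph_source _ hΨx (by simp)
  · exact hΨ.mono fun y hy => hy.2.1
  · intro z hz
    have hz' := (Φ.restrOpen O hO).map_target hz
    obtain ⟨B, hB⟩ := hz'.2.2
    have hc : ContDiffAt ℝ ∞ Ψ ((Φ.restrOpen O hO).symm z) :=
      hΨ.contDiffAt (hU.mem_nhds hz'.2.1)
    refine ((Φ.restrOpen O hO).contDiffAt_symm (f₀' := B) hz ?_ hc).contDiffWithinAt
    rw [hB]
    exact (hc.differentiableAt (by simp)).hasFDerivAt

theorem isInteriorPoint_of_submersion [FiniteDimensional ℝ V] [FiniteDimensional ℝ F] {g : V → F}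
    {N U : Set V} (hU : IsOpen U) (hg : ContDiffOn ℝ ∞ g U) {x : V} (hx : x ∈ U) (hxN : x ∈ N)
    (hsurj : Function.Surjective (fderiv ℝ g x)) {d : ℕ}
    (hd : Module.finrank ℝ V = d + Module.finrank ℝ F) (hN : ∀ y ∈ U, y ∈ N ↔ g y = 0) :
    IsInteriorPoint N d x := by
  obtain ⟨Φ, hxΦ, hΦU, hΦ, hΦs, hΦg⟩ := exists_chart_snd_eq hU hg hx hsurj hd
  let e : F ≃L[ℝ] EuclideanSpace ℝ (Fin (Module.finrank ℝ F)) :=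
    ContinuousLinearEquiv.ofFinrankEq (by simp)
  let E := (ContinuousLinearEquiv.refl ℝ (EuclideanSpace ℝ (Fin d))).prodCongr e
  refine ⟨hxN, Module.finrank ℝ F, Φ.transHomeomorph E.toHomeomorph, hxΦ,
    E.contDiff.comp_contDiffOn hΦ, hΦs.comp E.symm.contDiff.contDiffOn fun z hz => hz, ?_⟩
  ext y
  refine and_comm.trans (and_congr_right fun hy => (hN y (hΦU hy)).trans ?_)
  change _ ↔ e (Φ y).2 = 0
  rw [hΦg, map_eq_zero_iff e e.injective]

theorem isBoundaryPoint_of_submersion [FiniteDimensional ℝ V] [FiniteDimensional ℝ F]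
    {ρ : V → ℝ} {g : V → F} {N U : Set V} (hU : IsOpen U)
    (hg : ContDiffOn ℝ ∞ (fun y => (ρ y, g y)) U) {x : V} (hx : x ∈ U) (hxN : x ∈ N)
    (hsurj : Function.Surjective (fderiv ℝ (fun y => (ρ y, g y)) x)) {d : ℕ}
    (hd : Module.finrank ℝ V = d + Module.finrank ℝ F) (hd0 : 0 < d)
    (hN : ∀ y ∈ U, y ∈ N ↔ 0 ≤ ρ y ∧ g y = 0) (hρ : ρ x = 0) :
    IsBoundaryPoint N d x := by
  obtain ⟨k, rfl⟩ : ∃ k, d = k + 1 := ⟨d - 1, by omega⟩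
  obtain ⟨Φ, hxΦ, hΦU, hΦ, hΦs, hΦg⟩ := exists_chart_snd_eq hU hg hx hsurj (d := k)
    (by rw [hd, Module.finrank_prod, Module.finrank_self]; ring)
  let e : F ≃L[ℝ] EuclideanSpace ℝ (Fin (Module.finrank ℝ F)) :=
    ContinuousLinearEquiv.ofFinrankEq (by simp)
  let E : (EuclideanSpace ℝ (Fin k) × ℝ × F) ≃L[ℝ] (ℝ × EuclideanSpace ℝ (Fin k)) ×
      EuclideanSpace ℝ (Fin (Module.finrank ℝ F)) :=
    (ContinuousLinearEquiv.prodAssoc ℝ _ _ _).symm.trans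
      ((ContinuousLinearEquiv.prodComm ℝ _ _).prodCongr e)
  have hE1 : ∀ z, (E z).1.1 = z.2.1 := fun z => rfl
  have hE2 : ∀ z, (E z).2 = e z.2.2 := fun z => rfl
  refine ⟨hxN, k, Module.finrank ℝ F, Φ.transHomeomorph E.toHomeomorph, rfl, hxΦ,
    E.contDiff.comp_contDiffOn hΦ, hΦs.comp E.symm.contDiff.contDiffOn fun z hz => hz, ?_, ?_⟩
  · ext y
    refine and_comm.trans (and_congr_right fun hy => (hN y (hΦU hy)).trans ?_)
    change _ ↔ 0 ≤ (E (Φ y)).1.1 ∧ (E (Φ y)).2 = 0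
    rw [hE1, hE2, hΦg, map_eq_zero_iff e e.injective]
  · change (E (Φ x)).1.1 = 0
    rw [hE1, hΦg, hρ]

theorem tangentSubspace_mono {S T : Set V} (h : S ⊆ T) (x : V) :
    tangentSubspace S x ≤ tangentSubspace T x :=
  Submodule.span_mono (tangentConeAt_mono h)

/-- The derivative of `g` maps tangent vectors of `N` to tangent vectors of `{0}`, and an isolated
point has only the zero one. -/
theorem tangentSubspace_le_ker {g : V → F} {g' : V →L[ℝ] F} {N U : Set V} {x : V}
    (hU : U ∈ 𝓝 x) (hg : HasFDerivAt g g' x) (hN : ∀ y ∈ N ∩ U, g y = 0) (hgx : g x = 0) :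
    tangentSubspace N x ≤ g'.ker := by
  refine Submodule.span_le.2 fun v hv => ?_
  rw [← tangentConeAt_inter_nhds hU] at hv
  have h1 := (hg.hasFDerivWithinAt (s := N ∩ U)).mapsTo_tangent_cone hv
  have h2 : g '' (N ∩ U) ⊆ {0} := by
    rintro _ ⟨y, hy, rfl⟩
    exact hN y hy
  have h3 := tangentConeAt_mono (𝕜 := ℝ) (x := g x) h2 h1
  have h4 := tangentConeAt_subset_zero (𝕜 := ℝ) (s := {(0 : F)}) (x := g x) (by
    rw [hgx, accPt_iff_nhds]
    intro h
    obtain ⟨y, hy, hne⟩ := h univ univ_mem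
    exact hne hy.2) h3
  exact h4

/-- The kernel of the derivative of a submersion is tangent to its level set. -/
theorem ker_le_tangentSubspace [CompleteSpace V] [FiniteDimensional ℝ F] {g : V → F}
    {g' : V →L[ℝ] F} {N : Set V} {x : V} (hg : HasStrictFDerivAt g g' x)
    (hsurj : Function.Surjective g') (hgx : g x = 0) (hN : ∀ᶠ y in 𝓝 x, g y = 0 → y ∈ N) :
    g'.ker ≤ tangentSubspace N x := by
  intro v hv
  obtain ⟨γ, hγ, h0, hgγ⟩ := hg.exists_curve hsurj hv
  refine Submodule.subset_span (mem_tangentConeAt_of_curve hγ h0 (Eventually.filter_mono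
    nhdsWithin_le_nhds ?_))
  have h1 : Tendsto γ (𝓝 0) (𝓝 x) := h0 ▸ hγ.continuousAt.tendsto
  filter_upwards [h1.eventually hN, hgγ] with t ht1 ht2
  exact ht1 (ht2.trans hgx)

/-- At a boundary point of `{0 ≤ ρ, g = 0}`, a vector along which `g` is constant to first order
and `ρ` increases is tangent to `{0 < ρ, g = 0}`. -/
theorem mem_tangentConeAt_of_pos [CompleteSpace V] [FiniteDimensional ℝ F] {ρ : V → ℝ} {g : V → F}
    {ρ' : V →L[ℝ] ℝ} {g' : V →L[ℝ] F} {N : Set V} {x v : V} (hρ : HasFDerivAt ρ ρ' x)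
    (hg : HasStrictFDerivAt g g' x) (hsurj : Function.Surjective g') (hρx : ρ x = 0)
    (hgx : g x = 0) (hN : ∀ᶠ y in 𝓝 x, 0 < ρ y → g y = 0 → y ∈ N) (hv : g' v = 0)
    (hρv : 0 < ρ' v) : v ∈ tangentConeAt ℝ N x := by
  obtain ⟨γ, hγ, h0, hgγ⟩ := hg.exists_curve hsurj hv
  refine mem_tangentConeAt_of_curve hγ h0 ?_
  have h1 : Tendsto γ (𝓝 0) (𝓝 x) := h0 ▸ hγ.continuousAt.tendsto
  have h2 : HasDerivAt (fun t => ρ (γ t)) (ρ' v) 0 :=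
    HasFDerivAt.comp_hasDerivAt (0 : ℝ) (by rwa [h0]) hγ
  have h3 : ∀ᶠ t in 𝓝[>] (0 : ℝ), 0 < t⁻¹ • (ρ (γ (0 + t)) - ρ (γ 0)) :=
    h2.tendsto_slope_zero_right.eventually (lt_mem_nhds hρv)
  filter_upwards [h3, self_mem_nhdsWithin, nhdsWithin_le_nhds (h1.eventually hN),
    nhdsWithin_le_nhds hgγ] with t ht1 ht2 ht3 ht4
  refine ht3 ?_ (ht4.trans hgx)
  rw [zero_add, h0, hρx, sub_zero, smul_eq_mul] at ht1
  exact (pos_iff_pos_of_mul_pos ht1).1 (inv_pos.2 ht2)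

/-- A submanifold is, near each of its points, the zero set of a submersion. -/
theorem IsInteriorPoint.exists_submersion [FiniteDimensional ℝ V] {N : Set V} {d : ℕ} {x : V}
    (h : IsInteriorPoint N d x) :
    ∃ (c : ℕ) (g : V → EuclideanSpace ℝ (Fin c)) (U : Set V), IsOpen U ∧ x ∈ U ∧
      ContDiffOn ℝ ∞ g U ∧ Function.Surjective (fderiv ℝ g x) ∧
      (∀ y ∈ U, y ∈ N ↔ g y = 0) ∧ Module.finrank ℝ V = d + c := by
  obtain ⟨hxN, c, Φ, hx, hΦ, hΦs, hN⟩ := h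
  have hΦx : DifferentiableAt ℝ Φ x :=
    (hΦ.contDiffAt (Φ.open_source.mem_nhds hx)).differentiableAt (by simp)
  have hΦsx : DifferentiableAt ℝ Φ.symm (Φ x) :=
    (hΦs.contDiffAt (Φ.open_target.mem_nhds (Φ.map_source hx))).differentiableAt (by simp)
  have h1 : (fderiv ℝ Φ x) ∘L (fderiv ℝ Φ.symm (Φ x)) = ContinuousLinearMap.id ℝ _ := by
    have h2 : HasFDerivAt Φ (fderiv ℝ Φ x) (Φ.symm (Φ x)) := by
      rw [Φ.left_inv hx]; exact hΦx.hasFDerivAt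
    refine (h2.comp (Φ x) hΦsx.hasFDerivAt).unique ((hasFDerivAt_id _).congr_of_eventuallyEq ?_)
    filter_upwards [Φ.open_target.mem_nhds (Φ.map_source hx)] with z hz
    exact Φ.right_inv hz
  have h2 : (fderiv ℝ Φ.symm (Φ x)) ∘L (fderiv ℝ Φ x) = ContinuousLinearMap.id ℝ _ := by
    refine (hΦsx.hasFDerivAt.comp x hΦx.hasFDerivAt).unique
      ((hasFDerivAt_id _).congr_of_eventuallyEq ?_)
    filter_upwards [Φ.open_source.mem_nhds hx] with z hz
    exact Φ.left_inv hz
  let A := ContinuousLinearEquiv.equivOfInverse' _ _ h1 h2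
  refine ⟨c, fun y => (Φ y).2, Φ.source, Φ.open_source, hx, contDiff_snd.comp_contDiffOn hΦ,
    ?_, ?_, ?_⟩
  · have h3 : HasFDerivAt (fun y => (Φ y).2) _ x := hΦx.hasFDerivAt.snd
    rw [h3.fderiv]
    intro w
    exact ⟨fderiv ℝ Φ.symm (Φ x) (0, w), congrArg Prod.snd (DFunLike.congr_fun h1 (0, w))⟩
  · intro y hy
    have := Set.ext_iff.1 hN y
    simpa [hy] using this
  · simpa using A.toLinearEquiv.finrank_eq

/-- Read an interior parametrization in a boundary chart: the half-line coordinate has a minimum at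
the point, so its differential vanishes, and an injective linear map `ℝ^(k+1) → ℝ^k` would result.
-/
theorem IsInteriorPoint.not_isBoundaryPoint {N : Set V} {d : ℕ} {x : V}
    (h : IsInteriorPoint N d x) : ¬ IsBoundaryPoint N d x := by
  obtain ⟨-, c, Φ, hxΦ, hΦ, hΦs, hNΦ⟩ := h
  rintro ⟨hxN, k, c', Ψ, rfl, hxΨ, hΨ, hΨs, hNΨ, hΨ0⟩
  have hΦx2 : (Φ x).2 = 0 := ((Set.ext_iff.1 hNΦ x).1 ⟨hxN, hxΦ⟩).2
  set z₀ := (Φ x).1 with hz₀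
  have hz : (z₀, (0 : EuclideanSpace ℝ (Fin c))) = Φ x := Prod.ext rfl hΦx2.symm
  let γ : EuclideanSpace ℝ (Fin (k + 1)) → V := fun z => Φ.symm (z, 0)
  have hγ0 : γ z₀ = x := by simp only [γ, hz, Φ.left_inv hxΦ]
  have hγd : DifferentiableAt ℝ γ z₀ := by
    have h1 : DifferentiableAt ℝ Φ.symm (z₀, 0) := by
      rw [hz]
      exact (hΦs.contDiffAt (Φ.open_target.mem_nhds (Φ.map_source hxΦ))).differentiableAt (by simp)
    exact DifferentiableAt.comp z₀ (g := Φ.symm) h1 (by fun_prop)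
  have hγt : ∀ᶠ z in 𝓝 z₀, (z, (0 : EuclideanSpace ℝ (Fin c))) ∈ Φ.target := by
    have hc : ContinuousAt (fun z : EuclideanSpace ℝ (Fin (k + 1)) =>
      (z, (0 : EuclideanSpace ℝ (Fin c)))) z₀ := by fun_prop
    exact hc.eventually (Φ.open_target.mem_nhds (by simpa only [hz] using Φ.map_source hxΦ))
  have hγΨ : ∀ᶠ z in 𝓝 z₀, γ z ∈ Ψ.source :=
    hγd.continuousAt.eventually (Ψ.open_source.mem_nhds (hγ0.symm ▸ hxΨ))
  have hγN : ∀ᶠ z in 𝓝 z₀, 0 ≤ (Ψ (γ z)).1.1 ∧ (Ψ (γ z)).2 = 0 := by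
    filter_upwards [hγt, hγΨ] with z hzt hzΨ
    have h1 : γ z ∈ N ∩ Φ.source := by
      rw [hNΦ]
      exact ⟨Φ.map_target hzt, by simp only [γ, Φ.right_inv hzt]⟩
    have h2 : γ z ∈ N ∩ Ψ.source := ⟨h1.1, hzΨ⟩
    rw [hNΨ] at h2
    exact h2.2
  have hΨd : DifferentiableAt ℝ Ψ (γ z₀) := by
    rw [hγ0]
    exact (hΨ.contDiffAt (Ψ.open_source.mem_nhds hxΨ)).differentiableAt (by simp)
  have hθ : HasFDerivAt (fun z => Ψ (γ z)) (fderiv ℝ (fun z => Ψ (γ z)) z₀) z₀ :=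
    (hΨd.comp z₀ hγd).hasFDerivAt
  set θ' := fderiv ℝ (fun z => Ψ (γ z)) z₀
  have hθ2 : ∀ v, (θ' v).2 = 0 := by
    have h1 : HasFDerivAt (fun z => (Ψ (γ z)).2) _ z₀ := hθ.snd
    have h2 := h1.unique ((hasFDerivAt_const _ z₀).congr_of_eventuallyEq
      (hγN.mono fun z hz => hz.2))
    exact fun v => DFunLike.congr_fun h2 v
  have hθ1 : ∀ v, (θ' v).1.1 = 0 := by
    have h1 : HasFDerivAt (fun z => (Ψ (γ z)).1.1) _ z₀ := hθ.fst.fst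
    have h2 : IsLocalMin (fun z => (Ψ (γ z)).1.1) z₀ := by
      filter_upwards [hγN] with z hz
      rw [hγ0, hΨ0]
      exact hz.1
    exact fun v => DFunLike.congr_fun (h2.hasFDerivAt_eq_zero h1) v
  -- Going back through `Ψ.symm` and the slice coordinates of `Φ` is a differentiable left inverse.
  have hinj : Function.Injective θ' := by
    have hΨsd : DifferentiableAt ℝ Ψ.symm (Ψ (γ z₀)) := by
      rw [hγ0]
      exact (hΨs.contDiffAt (Ψ.open_target.mem_nhds (Ψ.map_source hxΨ))).differentiableAt (by simp)
    have hΦd : DifferentiableAt ℝ (fun y => (Φ y).1) (Ψ.symm (Ψ (γ z₀))) := by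
      rw [hγ0, Ψ.left_inv hxΨ]
      exact ((hΦ.contDiffAt (Φ.open_source.mem_nhds hxΦ)).differentiableAt (by simp)).fst
    have h1 := (hΦd.hasFDerivAt.comp _ hΨsd.hasFDerivAt).comp z₀ hθ
    have h2 := h1.unique ((hasFDerivAt_id z₀).congr_of_eventuallyEq (by
      filter_upwards [hγt, hγΨ] with z hzt hzΨ
      simp only [Function.comp, Ψ.left_inv hzΨ, γ, Φ.right_inv hzt, id]))
    exact Function.LeftInverse.injective (g := (fderiv ℝ (fun y => (Φ y).1) _) ∘L
      (fderiv ℝ Ψ.symm _)) fun v => DFunLike.congr_fun h2 v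
  let B : EuclideanSpace ℝ (Fin (k + 1)) →ₗ[ℝ] EuclideanSpace ℝ (Fin k) :=
    LinearMap.snd ℝ ℝ _ ∘ₗ LinearMap.fst ℝ _ (EuclideanSpace ℝ (Fin c')) ∘ₗ θ'.toLinearMap
  have hB : Function.Injective B := by
    refine (injective_iff_map_eq_zero B).2 fun v hv => hinj ?_
    rw [map_zero]
    exact Prod.ext (Prod.ext (hθ1 v) hv) (hθ2 v)
  have := LinearMap.finrank_le_finrank_of_injective hB
  simp at this

end LevelSets

/-! ### Homogeneous coordinates on the chart at infinity -/

section Homogenize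

variable {𝕂 : Type*} [RCLike 𝕂] {n : ℕ}

/-- The homogeneous coordinates `(u, r)` of the point of `𝕂ℙⁿ` which is `u / r` if `r ≠ 0`, and
the point at infinity in the direction `u` if `r = 0`. -/
def homogenize (p : ℝ × EuclideanSpace 𝕂 (Fin n)) : Fin (n + 1) → 𝕂 :=
  (Fin.last n).insertNth (p.1 : 𝕂) (fun j => p.2 j)

@[simp]
theorem homogenize_last (p : ℝ × EuclideanSpace 𝕂 (Fin n)) :
    homogenize p (Fin.last n) = (p.1 : 𝕂) := by
  simp [homogenize]

@[simp]
theorem homogenize_castSucc (p : ℝ × EuclideanSpace 𝕂 (Fin n)) (j : Fin n) :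
    homogenize p j.castSucc = p.2 j := by
  rw [homogenize, ← Fin.succAbove_last_apply, Fin.insertNth_apply_succAbove]

theorem homogenize_add_smul (p q : ℝ × EuclideanSpace 𝕂 (Fin n)) (t : ℝ) :
    homogenize (p + t • q) = homogenize p + (t : 𝕂) • homogenize q := by
  funext i
  induction i using Fin.lastCases with
  | last => simp
  | cast j => simp [RCLike.real_smul_eq_coe_mul]

theorem homogenize_zero : homogenize (0 : ℝ × EuclideanSpace 𝕂 (Fin n)) = 0 := by
  funext i
  induction i using Fin.lastCases with
  | last => simp
  | cast j => simp

theorem homogenize_smul (p : ℝ × EuclideanSpace 𝕂 (Fin n)) (t : ℝ) :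
    homogenize (t • p) = (t : 𝕂) • homogenize p := by
  simpa [homogenize_zero] using homogenize_add_smul 0 p t

theorem contDiff_homogenize (i : Fin (n + 1)) :
    ContDiff ℝ ∞ fun p : ℝ × EuclideanSpace 𝕂 (Fin n) => homogenize p i := by
  induction i using Fin.lastCases with
  | last =>
    simp only [homogenize_last]
    exact (RCLike.ofRealCLM (K := 𝕂)).contDiff.comp contDiff_fst
  | cast j =>
    simp only [homogenize_castSucc]
    exact (PiLp.proj (𝕜 := ℝ) 2 (fun _ : Fin n => 𝕂) j).contDiff.comp contDiff_snd

theorem homogenize_ne_zero {p : ℝ × EuclideanSpace 𝕂 (Fin n)} (hp : p.2 ≠ 0) :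
    homogenize p ≠ 0 := by
  contrapose! hp
  ext j
  simpa using congrFun hp j.castSucc

/-- The coordinates in the `i`-th affine chart of the point with homogeneous coordinates
`homogenize p`. -/
def affineCoord (i : Fin (n + 1)) (p : ℝ × EuclideanSpace 𝕂 (Fin n)) : EuclideanSpace 𝕂 (Fin n) :=
  WithLp.toLp 2 fun j => homogenize p (i.succAbove j) / homogenize p i

theorem affineEmbedding_affineCoord {i : Fin (n + 1)} {p : ℝ × EuclideanSpace 𝕂 (Fin n)}
    (hi : homogenize p i ≠ 0) (h : homogenize p ≠ 0) :
    affineEmbedding i (affineCoord i p) = Projectivization.mk 𝕂 (homogenize p) h := by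
  rw [affineEmbedding, Projectivization.mk_eq_mk_iff']
  refine ⟨(homogenize p i)⁻¹, ?_⟩
  funext k
  rcases eq_or_ne k i with rfl | hk
  · simp [hi]
  · obtain ⟨j, rfl⟩ := Fin.exists_succAbove_eq hk
    simp [affineCoord, div_eq_inv_mul]

/-- The set of all `p` for which `homogenize p` represents a point of `X`. -/
def conePreimage (X : Set (ℙ 𝕂 (Fin (n + 1) → 𝕂))) : Set (ℝ × EuclideanSpace 𝕂 (Fin n)) :=
  {p | ∃ h : homogenize p ≠ 0, Projectivization.mk 𝕂 (homogenize p) h ∈ X}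

theorem mem_conePreimage_iff {X : Set (ℙ 𝕂 (Fin (n + 1) → 𝕂))} {i : Fin (n + 1)}
    {p : ℝ × EuclideanSpace 𝕂 (Fin n)} (hi : homogenize p i ≠ 0) :
    p ∈ conePreimage X ↔ affineCoord i p ∈ affineEmbedding i ⁻¹' X := by
  have h : homogenize p ≠ 0 := fun h => hi (congrFun h i)
  rw [mem_preimage, affineEmbedding_affineCoord hi h]
  exact ⟨fun h' => h'.2, fun h' => ⟨h, h'⟩⟩

theorem affineCoord_last (p : ℝ × EuclideanSpace 𝕂 (Fin n)) :
    affineCoord (Fin.last n) p = p.1⁻¹ • p.2 := by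
  ext j
  simp [affineCoord, RCLike.real_smul_eq_coe_mul, div_eq_inv_mul]

theorem isOpen_homogenize_ne_zero (i : Fin (n + 1)) :
    IsOpen {p : ℝ × EuclideanSpace 𝕂 (Fin n) | homogenize p i ≠ 0} :=
  isOpen_ne_fun (contDiff_homogenize i).continuous continuous_const

theorem contDiffOn_affineCoord (i : Fin (n + 1)) :
    ContDiffOn ℝ ∞ (affineCoord i) {p : ℝ × EuclideanSpace 𝕂 (Fin n) | homogenize p i ≠ 0} := by
  rw [contDiffOn_piLp]
  intro j
  simp only [affineCoord, div_eq_mul_inv]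
  exact (contDiff_homogenize _).contDiffOn.mul ((contDiff_homogenize i).contDiffOn.inv fun p hp => hp)

theorem hasFDerivAt_affineCoord {i : Fin (n + 1)} {p : ℝ × EuclideanSpace 𝕂 (Fin n)}
    (hi : homogenize p i ≠ 0) :
    HasFDerivAt (affineCoord i) (fderiv ℝ (affineCoord i) p) p :=
  (((contDiffOn_affineCoord i).contDiffAt
    ((isOpen_homogenize_ne_zero i).mem_nhds hi)).differentiableAt (by simp)).hasFDerivAt

theorem HasFDerivAt.apply_eq_of_eventually_affine {V F : Type*} [NormedAddCommGroup V]
    [NormedSpace ℝ V] [NormedAddCommGroup F] [NormedSpace ℝ F] {f : V → F} {f' : V →L[ℝ] F}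
    {p q : V} {w : F} (hf : HasFDerivAt f f' p)
    (h : ∀ᶠ t in 𝓝 (0 : ℝ), f (p + t • q) = f p + t • w) : f' q = w := by
  have h1 := hf.hasLineDerivAt q
  have h2 : HasDerivAt (fun t : ℝ => f p + t • w) w 0 := by
    simpa using ((hasDerivAt_id (0 : ℝ)).smul_const w).const_add (f p)
  exact HasDerivAt.unique h1 (h2.congr_of_eventuallyEq h)

/-- Affine coordinates are homogeneous of degree zero, hence constant along rays. -/
theorem fderiv_affineCoord_self {i : Fin (n + 1)} {p : ℝ × EuclideanSpace 𝕂 (Fin n)}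
    (hi : homogenize p i ≠ 0) : fderiv ℝ (affineCoord i) p p = 0 := by
  refine (hasFDerivAt_affineCoord hi).apply_eq_of_eventually_affine ?_
  filter_upwards [lt_mem_nhds (show (-1 : ℝ) < 0 by norm_num)] with t ht
  have h1 : (1 : 𝕂) + t ≠ 0 := by
    have h2 : (1 + t : ℝ) ≠ 0 := by linarith
    exact_mod_cast h2
  have h3 : homogenize (p + t • p) = (1 + (t : 𝕂)) • homogenize p := by
    rw [homogenize_add_smul, add_smul, one_smul]
  ext j
  simp [affineCoord, h3, mul_div_mul_left _ _ h1]

/-- Along `q` the denominator is constant, so the quotient is affine in the parameter. -/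
theorem fderiv_affineCoord_apply {i : Fin (n + 1)} {p q : ℝ × EuclideanSpace 𝕂 (Fin n)}
    (hi : homogenize p i ≠ 0) (hq : homogenize q i = 0) :
    fderiv ℝ (affineCoord i) p q =
      WithLp.toLp 2 fun j => homogenize q (i.succAbove j) / homogenize p i := by
  refine (hasFDerivAt_affineCoord hi).apply_eq_of_eventually_affine (Eventually.of_forall ?_)
  intro t
  ext j
  simp [affineCoord, homogenize_add_smul, hq, RCLike.real_smul_eq_coe_mul, add_div, mul_div_assoc]

theorem mk_mem_hyperplaneAtInfinity_iff {v : Fin (n + 1) → 𝕂} (hv : v ≠ 0) :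
    Projectivization.mk 𝕂 v hv ∈ hyperplaneAtInfinity 𝕂 n ↔ v (Fin.last n) = 0 := by
  rw [hyperplaneAtInfinity, mem_compl_iff, not_iff_comm]
  constructor
  · intro h
    refine ⟨WithLp.toLp 2 fun j => v j.castSucc / v (Fin.last n), ?_⟩
    rw [affineEmbedding, Projectivization.mk_eq_mk_iff']
    refine ⟨(v (Fin.last n))⁻¹, ?_⟩
    funext k
    induction k using Fin.lastCases with
    | last => simp [h]
    | cast j =>
      rw [← Fin.succAbove_last_apply, Fin.insertNth_apply_succAbove]
      simp [div_eq_inv_mul]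
  · rintro ⟨x, hx⟩ h
    rw [affineEmbedding, Projectivization.mk_eq_mk_iff'] at hx
    obtain ⟨a, ha⟩ := hx
    simpa [h] using congrFun ha (Fin.last n)

/-- On the chart `‖u‖ = 1` keeps the homogeneous coordinates away from zero, so the map to
projective space is defined and continuous on a closed set. -/
theorem isClosed_conePreimage {X : Set (ℙ 𝕂 (Fin (n + 1) → 𝕂))} (hX : IsClosed X) :
    IsClosed (chartAtInfinity (EuclideanSpace 𝕂 (Fin n)) ∩ conePreimage X) := by
  let E := EuclideanSpace 𝕂 (Fin n)
  have hC : IsClosed (chartAtInfinity E) := isClosed_Ici.prod Metric.isClosed_sphere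
  have h0 : ∀ p : chartAtInfinity E, homogenize p.1 ≠ 0 := fun p => homogenize_ne_zero (by
    have := p.2.2
    intro h
    simp [h] at this)
  let φ : chartAtInfinity E → {v : Fin (n + 1) → 𝕂 // v ≠ 0} := fun p => ⟨homogenize p.1, h0 p⟩
  have hφ : Continuous φ := Continuous.subtype_mk
    (continuous_pi fun i => (contDiff_homogenize i).continuous.comp continuous_subtype_val) _
  have hmk : Continuous (Projectivization.mk' 𝕂 : {v : Fin (n + 1) → 𝕂 // v ≠ 0} → _) :=
    continuous_coinduced_rng
  have h1 := hC.isClosedEmbedding_subtypeVal.isClosedMap _ (hX.preimage (hmk.comp hφ))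
  convert h1 using 1
  ext p
  constructor
  · rintro ⟨hp, h, hpX⟩
    exact ⟨⟨p, hp⟩, hpX, rfl⟩
  · rintro ⟨⟨p, hp⟩, hpX, rfl⟩
    exact ⟨hp, h0 ⟨p, hp⟩, hpX⟩

end Homogenize

/-! ### The equation of the cylinder over the unit sphere -/

section UnitSphere

variable {𝕂 E : Type*} [RCLike 𝕂] [NormedAddCommGroup E] [InnerProductSpace 𝕂 E] [NormedSpace ℝ E]

/-- The defining function of the cylinder over the unit sphere. -/
def cylinderFun (p : ℝ × E) : ℝ := ‖p.2‖ ^ 2 - 1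

theorem cylinderFun_eq_zero_iff {E : Type*} [NormedAddCommGroup E] {p : ℝ × E} :
    cylinderFun p = 0 ↔ ‖p.2‖ = 1 := by
  rw [cylinderFun, sub_eq_zero, pow_eq_one_iff_of_nonneg (norm_nonneg _) two_ne_zero]

variable (𝕂) in
include 𝕂 in
theorem contDiff_cylinderFun : ContDiff ℝ ∞ (cylinderFun : ℝ × E → ℝ) :=
  ((contDiff_norm_sq 𝕂).comp contDiff_snd).sub contDiff_const

theorem HasFDerivAt.cylinderFun_apply_self {E : Type*} [NormedAddCommGroup E] [NormedSpace ℝ E]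
    {p : ℝ × E} {L : ℝ × E →L[ℝ] ℝ} (h : HasFDerivAt cylinderFun L p) (hp : ‖p.2‖ = 1) :
    L p = 2 := by
  have h1 := h.hasLineDerivAt p
  have h2 : HasDerivAt (fun t : ℝ => (1 + t) ^ 2 - 1) 2 0 := by
    have := (((hasDerivAt_id (0 : ℝ)).const_add 1).pow 2).sub_const 1
    simpa using this
  refine HasDerivAt.unique h1 (h2.congr_of_eventuallyEq (Eventually.of_forall fun t => ?_))
  have : (p + t • p).2 = (1 + t) • p.2 := by rw [add_smul, one_smul]; rfl
  change ‖(p + t • p).2‖ ^ 2 - 1 = _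
  rw [this, norm_smul, hp, mul_one, Real.norm_eq_abs, sq_abs]

end UnitSphere

/-! ### The closure of the affine part as a p-submanifold -/

section ConeAtInfinity

variable {𝕂 : Type*} [RCLike 𝕂] {n d : ℕ} {X : Set (ℙ 𝕂 (Fin (n + 1) → 𝕂))}

/-- In the chart at infinity, a submanifold of projective space has local equations obtained from
those in an affine chart. -/
theorem IsProjectiveSubmanifold.exists_equations (hX : IsProjectiveSubmanifold X d)
    {i : Fin (n + 1)} {p : ℝ × EuclideanSpace 𝕂 (Fin n)} (hi : homogenize p i ≠ 0)
    (hp : p ∈ conePreimage X) :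
    ∃ (c : ℕ) (h : EuclideanSpace 𝕂 (Fin n) → EuclideanSpace ℝ (Fin c))
      (U : Set (EuclideanSpace 𝕂 (Fin n))) (O : Set (ℝ × EuclideanSpace 𝕂 (Fin n))),
      IsOpen O ∧ p ∈ O ∧ ContDiffOn ℝ ∞ (h ∘ affineCoord i) O ∧
      U ∈ 𝓝 (affineCoord i p) ∧ (∀ y ∈ U, y ∈ affineEmbedding i ⁻¹' X ↔ h y = 0) ∧
      (∀ y ∈ O, y ∈ conePreimage X ↔ h (affineCoord i y) = 0) ∧
      DifferentiableAt ℝ h (affineCoord i p) ∧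
      Function.Surjective (fderiv ℝ h (affineCoord i p)) ∧
      Module.finrank ℝ (ℝ × EuclideanSpace 𝕂 (Fin n)) =
        d + Module.finrank ℝ (ℝ × EuclideanSpace ℝ (Fin c)) := by
  obtain ⟨c, h, U, hU, hxU, hh, hsurj, hXU, hdim⟩ :=
    (hX i _ ((mem_conePreimage_iff hi).1 hp)).exists_submersion
  refine ⟨c, h, U, {q | homogenize q i ≠ 0} ∩ affineCoord i ⁻¹' U,
    (contDiffOn_affineCoord i).continuousOn.isOpen_inter_preimage (isOpen_homogenize_ne_zero i) hU,
    ⟨hi, hxU⟩, hh.comp ((contDiffOn_affineCoord i).mono inter_subset_left) fun q hq => hq.2,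
    hU.mem_nhds hxU, hXU, fun y hy => (mem_conePreimage_iff hy.1).trans (hXU _ hy.2),
    (hh.contDiffAt (hU.mem_nhds hxU)).differentiableAt (by simp), hsurj, ?_⟩
  rw [Module.finrank_prod, Module.finrank_prod, hdim, Module.finrank_self,
    finrank_euclideanSpace_fin]
  ring

theorem isInteriorPoint_of_fst_pos (hX : IsProjectiveSubmanifold X d)
    {p : ℝ × EuclideanSpace 𝕂 (Fin n)}
    (hp : p ∈ chartAtInfinity (EuclideanSpace 𝕂 (Fin n)) ∩ conePreimage X) (hp0 : 0 < p.1) :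
    IsInteriorPoint (chartAtInfinity (EuclideanSpace 𝕂 (Fin n)) ∩ conePreimage X) d p := by
  have hi : homogenize p (Fin.last n) ≠ 0 := by simpa using hp0.ne'
  obtain ⟨c, h, U, O, hO, hpO, hg, -, -, hXO, hh, hsurj, hdim⟩ := hX.exists_equations hi hp.2
  have hnorm : ‖p.2‖ = 1 := by simpa using hp.1.2
  have hQ : DifferentiableAt ℝ (cylinderFun : ℝ × EuclideanSpace 𝕂 (Fin n) → ℝ) p :=
    (contDiff_cylinderFun 𝕂).differentiable (by simp) p
  have hf := hasFDerivAt_affineCoord hi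
  refine isInteriorPoint_of_submersion
    (g := fun q => (cylinderFun q, h (affineCoord (Fin.last n) q)))
    (hO.inter (isOpen_lt continuous_const continuous_fst))
    ((contDiff_cylinderFun 𝕂).contDiffOn.prodMk (hg.mono inter_subset_left)) ⟨hpO, hp0⟩ hp ?_ hdim ?_
  · have hD : HasFDerivAt (fun q => (cylinderFun q, h (affineCoord (Fin.last n) q))) _ p :=
      hQ.hasFDerivAt.prodMk (hh.hasFDerivAt.comp p hf)
    rw [hD.fderiv]
    rintro ⟨a, w⟩
    obtain ⟨y, rfl⟩ := hsurj w
    -- In the last chart the coordinate is `u / r`; the factor `p.1` cancels the division.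
    let q : ℝ × EuclideanSpace 𝕂 (Fin n) := (0, p.1 • y)
    have hq : fderiv ℝ (affineCoord (Fin.last n)) p q = y := by
      rw [fderiv_affineCoord_apply hi (by simp [q])]
      ext j
      simp [q, RCLike.real_smul_eq_coe_mul, hp0.ne']
    set L := fderiv ℝ (cylinderFun : ℝ × EuclideanSpace 𝕂 (Fin n) → ℝ) p
    have hL : L p = 2 := hQ.hasFDerivAt.cylinderFun_apply_self hnorm
    -- Adding a multiple of `p` corrects the norm equation, as `L p = 2`, without affecting the
    -- projective one.
    refine ⟨q + ((a - L q) / 2) • p, ?_⟩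
    simp [hq, hL, fderiv_affineCoord_self hi]
  · rintro q ⟨hqO, hq0⟩
    rw [mem_inter_iff, hXO q hqO, Prod.mk_eq_zero, cylinderFun_eq_zero_iff]
    simp [chartAtInfinity, (show (0 : ℝ) < q.1 from hq0).le]

/-- A submanifold transverse to the hyperplane at infinity is, in the chart at infinity and near
the boundary, the half space `0 ≤ r` in a submanifold transverse to the boundary. -/
theorem boundary_of_fst_eq_zero (hX : IsProjectiveSubmanifold X d) (hd : 0 < d)
    (htrans : ProjectiveTransverse X (hyperplaneAtInfinity 𝕂 n))
    {p : ℝ × EuclideanSpace 𝕂 (Fin n)}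
    (hp : p ∈ chartAtInfinity (EuclideanSpace 𝕂 (Fin n)) ∩ conePreimage X) (hp0 : p.1 = 0) :
    IsBoundaryPoint (chartAtInfinity (EuclideanSpace 𝕂 (Fin n)) ∩ conePreimage X) d p ∧
    ∃ v ∈ tangentConeAt ℝ
      (chartAtInfinity (EuclideanSpace 𝕂 (Fin n)) ∩ conePreimage X ∩ {q | 0 < q.1}) p, v.1 = 1 := by
  have hnorm : ‖p.2‖ = 1 := by simpa using hp.1.2
  -- At infinity the last chart is unavailable; a nonzero coordinate of `u` selects another.
  obtain ⟨j, hj⟩ : ∃ j, p.2 j ≠ 0 := by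
    by_contra! hcon
    have : p.2 = 0 := by ext j; simpa using hcon j
    simp [this] at hnorm
  set i : Fin (n + 1) := j.castSucc
  have hi : homogenize p i ≠ 0 := by simpa [i] using hj
  obtain ⟨c, h, U, O, hO, hpO, hg, hU, hXU, hXO, hh, hsurj, hdim⟩ := hX.exists_equations hi hp.2
  have hQ : DifferentiableAt ℝ (cylinderFun : ℝ × EuclideanSpace 𝕂 (Fin n) → ℝ) p :=
    (contDiff_cylinderFun 𝕂).differentiable (by simp) p
  have hf := hasFDerivAt_affineCoord hi
  obtain ⟨k, hk⟩ : ∃ k, i.succAbove k = Fin.last n :=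
    Fin.exists_succAbove_eq (Fin.castSucc_lt_last j).ne'
  -- Transversality: split `y` into a part tangent to `X`, killed by the differential of `h`, and a
  -- part tangent to the hyperplane, which is `z k = 0` in this chart.
  have hspan : ∀ y : EuclideanSpace 𝕂 (Fin n), ∃ b : EuclideanSpace 𝕂 (Fin n), b k = 0 ∧
      fderiv ℝ h (affineCoord i p) b = fderiv ℝ h (affineCoord i p) y := by
    intro y
    have hmem : affineEmbedding i (affineCoord i p) ∈ X ∩ hyperplaneAtInfinity 𝕂 n := by
      refine ⟨(mem_conePreimage_iff hi).1 hp.2, ?_⟩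
      rw [affineEmbedding_affineCoord hi fun h => hi (congrFun h i),
        mk_mem_hyperplaneAtInfinity_iff, homogenize_last, hp0, RCLike.ofReal_zero]
    have hH : ∀ z : EuclideanSpace 𝕂 (Fin n),
        z ∈ affineEmbedding i ⁻¹' hyperplaneAtInfinity 𝕂 n ↔ z k = 0 := by
      intro z
      rw [mem_preimage, affineEmbedding, mk_mem_hyperplaneAtInfinity_iff, ← hk,
        Fin.insertNth_apply_succAbove]
    have hy : y ∈ tangentSubspace (affineEmbedding i ⁻¹' X) (affineCoord i p) ⊔
        tangentSubspace (affineEmbedding i ⁻¹' hyperplaneAtInfinity 𝕂 n) (affineCoord i p) := by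
      rw [htrans i _ hmem]
      exact Submodule.mem_top
    obtain ⟨a, ha, b, hb, rfl⟩ := Submodule.mem_sup.1 hy
    have ha' : fderiv ℝ h (affineCoord i p) a = 0 :=
      tangentSubspace_le_ker hU hh.hasFDerivAt (fun z hz => (hXU z hz.2).1 hz.1)
        ((hXU _ (mem_of_mem_nhds hU)).1 hmem.1) ha
    have hb' : b k = 0 :=
      tangentSubspace_le_ker univ_mem
        (PiLp.proj (𝕜 := ℝ) 2 (fun _ : Fin n => 𝕂) k).hasFDerivAt
        (fun z hz => (hH z).1 hz.1) ((hH _).1 hmem.2) hb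
    exact ⟨b, hb', by rw [map_add, ha', zero_add]⟩
  have hD : HasFDerivAt (fun q => (cylinderFun q, h (affineCoord i q)))
      ((fderiv ℝ cylinderFun p).prod
        ((fderiv ℝ h (affineCoord i p)) ∘L (fderiv ℝ (affineCoord i) p))) p :=
    hQ.hasFDerivAt.prodMk (hh.hasFDerivAt.comp p hf)
  have hG : ContDiffOn ℝ ∞ (fun q => (cylinderFun q, h (affineCoord i q))) O :=
    (contDiff_cylinderFun 𝕂).contDiffOn.prodMk hg
  set L := fderiv ℝ (cylinderFun : ℝ × EuclideanSpace 𝕂 (Fin n) → ℝ) p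
  have hL : L p = 2 := hQ.hasFDerivAt.cylinderFun_apply_self hnorm
  have honto : Function.Surjective ((ContinuousLinearMap.fst ℝ ℝ (EuclideanSpace 𝕂 (Fin n))).prod
      (L.prod ((fderiv ℝ h (affineCoord i p)) ∘L (fderiv ℝ (affineCoord i) p)))) := by
    rintro ⟨r, a, w⟩
    obtain ⟨y, hy⟩ := hsurj (w - fderiv ℝ h (affineCoord i p)
      (fderiv ℝ (affineCoord i) p (r, 0)))
    obtain ⟨b, hbk, hb⟩ := hspan y
    -- The lift of `b` to homogeneous coordinates. Its last entry vanishes because `b k = 0`, so it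
    -- comes from a vector with `r`-component `0`; over `ℂ` a general last entry would not even be
    -- real.
    let v : Fin (n + 1) → 𝕂 := i.insertNth 0 fun l => homogenize p i * b l
    have hvl : v (Fin.last n) = 0 := by
      rw [← hk]
      simp [v, hbk]
    let q : ℝ × EuclideanSpace 𝕂 (Fin n) := (0, WithLp.toLp 2 fun l => v l.castSucc)
    have hqv : homogenize q = v := by
      funext l
      induction l using Fin.lastCases with
      | last => simp [q, hvl]
      | cast l => simp [q]
    have hq : fderiv ℝ (affineCoord i) p q = b := by
      rw [fderiv_affineCoord_apply hi (by simp [hqv, v])]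
      ext l
      simp [hqv, v, hi]
    -- Since `p.1 = 0`, the radial correction leaves the `r`-component alone.
    refine ⟨(r, 0) + q + ((a - L ((r, 0) + q)) / 2) • p, ?_⟩
    refine Prod.ext ?_ (Prod.ext ?_ ?_)
    · simp [q, hp0]
    · simp [hL]
    · change fderiv ℝ h (affineCoord i p) (fderiv ℝ (affineCoord i) p _) = w
      simp only [map_add, map_smul, fderiv_affineCoord_self hi, hq, hb, hy, smul_zero, add_zero]
      abel
  have hmem : ∀ q ∈ O, q ∈ chartAtInfinity (EuclideanSpace 𝕂 (Fin n)) ∩ conePreimage X ↔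
      0 ≤ q.1 ∧ (cylinderFun q, h (affineCoord i q)) = 0 := by
    intro q hq
    rw [mem_inter_iff, hXO q hq, Prod.mk_eq_zero, cylinderFun_eq_zero_iff]
    simp [chartAtInfinity, and_assoc]
  refine ⟨isBoundaryPoint_of_submersion hO (contDiff_fst.contDiffOn.prodMk hG) hpO hp ?_ hdim hd
    hmem hp0, ?_⟩
  · rwa [(hasFDerivAt_fst.prodMk hD).fderiv]
  · obtain ⟨v, hv⟩ := honto (1, 0)
    obtain ⟨hv1, hv2⟩ := Prod.ext_iff.1 hv
    refine ⟨v, mem_tangentConeAt_of_pos hasFDerivAt_fst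
      ((hG.contDiffAt (hO.mem_nhds hpO)).hasStrictFDerivAt' hD (by simp)) ?_ hp0
      ((hmem p hpO).1 hp).2 ?_ hv2 ?_, hv1⟩
    · intro w
      obtain ⟨u, hu⟩ := honto (0, w)
      exact ⟨u, congrArg Prod.snd hu⟩
    · filter_upwards [hO.mem_nhds hpO] with q hq h1 h2
      exact ⟨(hmem q hq).2 ⟨h1.le, h2⟩, h1⟩
    · exact (zero_lt_one (α := ℝ)).trans_eq hv1.symm

theorem closureAtInfinity_affinePart (hclosed : IsClosed X) (hX : IsProjectiveSubmanifold X d)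
    (hd : 0 < d) (htrans : ProjectiveTransverse X (hyperplaneAtInfinity 𝕂 n)) :
    closureAtInfinity (affinePart X) =
      chartAtInfinity (EuclideanSpace 𝕂 (Fin n)) ∩ conePreimage X := by
  have hpos : {p : ℝ × EuclideanSpace 𝕂 (Fin n) |
      0 < p.1 ∧ ‖p.2‖ = 1 ∧ p.1⁻¹ • p.2 ∈ affinePart X} =
      chartAtInfinity (EuclideanSpace 𝕂 (Fin n)) ∩ conePreimage X ∩ {q | 0 < q.1} := by
    ext p
    refine Iff.trans (and_congr_right fun (hp0 : 0 < p.1) => ?_) and_comm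
    rw [mem_inter_iff, mem_conePreimage_iff (i := Fin.last n) (by simpa using hp0.ne'),
      affineCoord_last]
    simp [chartAtInfinity, affinePart, hp0.le]
  rw [closureAtInfinity, hpos]
  refine subset_antisymm (closure_minimal inter_subset_left (isClosed_conePreimage hclosed)) ?_
  intro p hp
  rcases (show (0 : ℝ) ≤ p.1 from hp.1.1).eq_or_lt with hp0 | hp0
  · obtain ⟨-, v, hv, -⟩ := boundary_of_fst_eq_zero hX hd htrans hp hp0.symm
    -- A tangent vector to the part `r > 0` exists at `p` only if `p` is a limit of such points.
    exact mem_closure_of_nonempty_tangentConeAt ⟨v, hv⟩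
  · exact subset_closure ⟨hp, hp0⟩

theorem asymptoticSet_affinePart_nonempty (hclosed : IsClosed X)
    (hX : IsProjectiveSubmanifold X d) (hd : 0 < d)
    (htrans : ProjectiveTransverse X (hyperplaneAtInfinity 𝕂 n))
    (hmeet : (X ∩ hyperplaneAtInfinity 𝕂 n).Nonempty) :
    (asymptoticSet (affinePart X)).Nonempty := by
  obtain ⟨x, hxX, hxH⟩ := hmeet
  induction x using Projectivization.ind with
  | h v hv =>
    rw [mk_mem_hyperplaneAtInfinity_iff] at hxH
    let u : EuclideanSpace 𝕂 (Fin n) := WithLp.toLp 2 fun j => v j.castSucc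
    have huv : homogenize ((0 : ℝ), u) = v := by
      funext l
      induction l using Fin.lastCases with
      | last => simp [hxH]
      | cast l => simp [u]
    have hu : u ≠ 0 := by
      intro hu
      refine hv (huv.symm.trans ?_)
      rw [hu]
      exact homogenize_zero
    have hun : ‖u‖⁻¹ ≠ 0 := inv_ne_zero (norm_ne_zero_iff.2 hu)
    have hsmul : homogenize (‖u‖⁻¹ • ((0 : ℝ), u)) = ((‖u‖⁻¹ : ℝ) : 𝕂) • v := by
      rw [homogenize_smul, huv]
    have hnorm : ‖(‖u‖⁻¹ • ((0 : ℝ), u)).2‖ = 1 := by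
      simp [norm_smul, hu]
    refine ⟨‖u‖⁻¹ • ((0 : ℝ), u), ?_, ?_⟩
    · rw [closureAtInfinity_affinePart hclosed hX hd htrans]
      refine ⟨⟨by simp, by simpa using hnorm⟩, ?_, ?_⟩
      · rw [hsmul]
        exact smul_ne_zero (by exact_mod_cast hun) hv
      · convert hxX using 1
        rw [Projectivization.mk_eq_mk_iff']
        exact ⟨_, hsmul.symm⟩
    · exact ⟨by simp, by simpa using hnorm⟩

theorem isPSubmanifold_conePreimage (hX : IsProjectiveSubmanifold X d)
    (hd : 0 < d) (htrans : ProjectiveTransverse X (hyperplaneAtInfinity 𝕂 n)) :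
    IsPSubmanifold (chartAtInfinity (EuclideanSpace 𝕂 (Fin n)))
      (sphereAtInfinity (EuclideanSpace 𝕂 (Fin n)))
      (chartAtInfinity (EuclideanSpace 𝕂 (Fin n)) ∩ conePreimage X) d := by
  have hbd : submanifoldBoundary (chartAtInfinity (EuclideanSpace 𝕂 (Fin n)) ∩ conePreimage X) d =
      chartAtInfinity (EuclideanSpace 𝕂 (Fin n)) ∩ conePreimage X ∩
        sphereAtInfinity (EuclideanSpace 𝕂 (Fin n)) := by
    ext p
    constructor
    · intro hp
      have hpN := hp.1
      refine ⟨hpN, ?_, hpN.1.2⟩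
      by_contra hp0
      exact (isInteriorPoint_of_fst_pos hX hpN
        (lt_of_le_of_ne hpN.1.1 (Ne.symm hp0))).not_isBoundaryPoint hp
    · rintro ⟨hpN, hp0, -⟩
      exact (boundary_of_fst_eq_zero hX hd htrans hpN hp0).1
  refine ⟨inter_subset_left, fun p hp => ?_, hbd, fun p hp => ?_⟩
  · rcases (show (0 : ℝ) ≤ p.1 from hp.1.1).eq_or_lt with hp0 | hp0
    · exact Or.inr (boundary_of_fst_eq_zero hX hd htrans hp hp0.symm).1
    · exact Or.inl (isInteriorPoint_of_fst_pos hX hp hp0)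
  · rw [hbd] at hp
    obtain ⟨hpN, hp0, -⟩ := hp
    replace hp0 : p.1 = 0 := hp0
    have hnorm : ‖p.2‖ = 1 := by simpa using hpN.1.2
    have hsub : sphereAtInfinity (EuclideanSpace 𝕂 (Fin n)) ⊆ chartAtInfinity _ :=
      prod_mono (by simp) subset_rfl
    refine le_antisymm (sup_le (tangentSubspace_mono inter_subset_left p)
      (tangentSubspace_mono hsub p)) ?_
    obtain ⟨-, v, hv, hv1⟩ := boundary_of_fst_eq_zero hX hd htrans hpN hp0
    have hvN : v ∈ tangentSubspace
        (chartAtInfinity (EuclideanSpace 𝕂 (Fin n)) ∩ conePreimage X) p :=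
      Submodule.subset_span (tangentConeAt_mono inter_subset_left hv)
    have hQ : HasStrictFDerivAt (cylinderFun : ℝ × EuclideanSpace 𝕂 (Fin n) → ℝ)
        (fderiv ℝ cylinderFun p) p :=
      (contDiff_cylinderFun 𝕂).contDiffAt.hasStrictFDerivAt (by simp)
    set L := fderiv ℝ (cylinderFun : ℝ × EuclideanSpace 𝕂 (Fin n) → ℝ) p
    have hL : L p = 2 := hQ.hasFDerivAt.cylinderFun_apply_self hnorm
    have hker : tangentSubspace (chartAtInfinity (EuclideanSpace 𝕂 (Fin n))) p ≤ L.ker :=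
      tangentSubspace_le_ker univ_mem hQ.hasFDerivAt
        (fun q hq => cylinderFun_eq_zero_iff.2 (by simpa using hq.1.2))
        (cylinderFun_eq_zero_iff.2 hnorm)
    have hsphere : ((ContinuousLinearMap.fst ℝ ℝ (EuclideanSpace 𝕂 (Fin n))).prod L).ker ≤
        tangentSubspace (sphereAtInfinity (EuclideanSpace 𝕂 (Fin n))) p := by
      refine ker_le_tangentSubspace (hasStrictFDerivAt_fst.prodMk hQ) ?_
        (Prod.ext hp0 (cylinderFun_eq_zero_iff.2 hnorm)) (Eventually.of_forall fun q hq => ?_)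
      · rintro ⟨r, a⟩
        refine ⟨(r, 0) + ((a - L (r, 0)) / 2) • p, ?_⟩
        simp [hp0, hL]
      · obtain ⟨h1, h2⟩ := Prod.ext_iff.1 hq
        exact ⟨h1, by simpa using cylinderFun_eq_zero_iff.1 h2⟩
    intro w hw
    have hLv : L v = 0 := hker (tangentSubspace_mono inter_subset_left p hvN)
    have hLw : L w = 0 := hker hw
    -- As `v` has `r`-component `1`, subtracting `w.1 • v` leaves a vector tangent to the sphere at
    -- infinity.
    rw [← add_sub_cancel (w.1 • v) w]
    refine Submodule.add_mem_sup (Submodule.smul_mem _ _ hvN) (hsphere ?_)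
    refine Prod.ext ?_ ?_
    · simp [hv1]
    · simp [hLv, hLw]

end ConeAtInfinity

theorem lemma4p2 {𝕂 : Type*} [RCLike 𝕂] (n d : ℕ)
    (X : Set (ℙ 𝕂 (Fin (n + 1) → 𝕂)))
    (hclosed : IsClosed X) (hconn : IsConnected X)
    (hX : IsProjectiveSubmanifold X d)
    (hdim : 0 < d) (hcodim : d < Module.finrank ℝ (EuclideanSpace 𝕂 (Fin n)))
    (hmeet : (X ∩ hyperplaneAtInfinity 𝕂 n).Nonempty)
    (htrans : ProjectiveTransverse X (hyperplaneAtInfinity 𝕂 n)) :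
    IsConicAtInfinity (affinePart X) := by
  refine Or.inr ⟨asymptoticSet_affinePart_nonempty hclosed hX hdim htrans hmeet, univ, isOpen_univ,
    subset_univ _, d, ?_⟩
  rw [closureAtInfinity_affinePart hclosed hX hdim htrans, inter_univ, inter_univ, inter_univ]
  exact isPSubmanifold_conePreimage hX hdim htrans
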